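/- Let $\Omega$ be a non-empty set and let $\mathfrak F(\Omega)$ be the space of all real functions on $\Omega$. Let $\ge_*$ be a reflexive, transitive relation on $\mathfrak F(\Omega)$, with asymmetric part $>_*$ ($f>_*g$ means that $f\ge_*g$ but not $g\ge_*f$), such that: $1>_*0$; $f\ge g$ pointwise implies $f\ge_*g$; $f\ge_*g$ implies $bf+h\ge_*bg+h$ for all bounded $b\ge0$ and all $h\in\mathfrak F(\Omega)$; and $f>_*0$ implies $f\wedge1>_*0$. Let $\mathcal X\subset\mathfrak F(\Omega)$ be a convex set containing $0$ and $1$ such that every $X\in\mathcal X$ satisfies $X\ge_*a$ for some $a\in\mathbb R$, and $X+\lambda\in\mathcal X$ for all $X\in\mathcal X$, $\lambda\ge0$. Let $\pi:\mathcal X\to\mathbb R$ satisfy $\pi(1)=1$, $\pi(\lambda X)=\lambda\pi(X)$ whenever $\lambda\ge0$ and $X,\lambda X\in\mathcal X$, $\pi(X+Y)\le\pi(X)+\pi(Y)$ whenever $X,Y,X+Y\in\mathcal X$, $\pi(X)\ge\pi(Y)$ whenever $X,Y\in\mathcal X$ and $X\ge_*Y$, and $\pi(X)>0$ whenever $X\in\mathcal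 X$ and $X>_*0$. Put $$L(\mathcal X)=\{g\in\mathfrak F(\Omega):\lambda X\ge_*|g|\text{ for some }\lambda>0,\ X\in\mathcal X\},$$ $$\mathcal C(\pi)=\{g\in\mathfrak F(\Omega):\lambda[X-\pi(X)]\ge_*g\text{ for some }\lambda>0,\ X\in\mathcal X\},$$ and let $\mathcal M_0(\pi)$ be the set of finitely additive probabilities $m$ on the power set of $\Omega$ such that $L(\mathcal X)\subset L^1(m)$ and $\int X\,dm\le\pi(X)$ for every $X\in\mathcal X$, where $L^1(m)$ and the integral are those of Dunford and Schwartz for finitely additive set functions. For $A\subset\mathfrak F(\Omega)$ let $\overline{A}^{u}$ be its closure in the topology of uniform distance, and let $\overline{A}^{L^1(m)}$ be the set of those $f\in\mathfrak F(\Omega)$ such that for every $\varepsilon>0$ there is $h\in A$ with $f-h\in L^1(m)$ and $\int|f-h|\,dm<\varepsilon$. Then $$\overline{\mathcal C(\pi)}^{u}\cap\{f\in\mathfrak F(\Omega):f>_*0\}=\varnothing$$ if and only if $$\bigcap_{m\in\mathcal M_0(\pi)}\overline{\mathcal C(\pi)}^{L^1(m)}\cap\{f\in\mathfrak F(\Omega):f>_*0\}=\varnothing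 .$$ -/

import Mathlib

open Filter Topology

namespace FinAddMarket

/-! ### The order of collective rationality -/

/-- The asymmetric part of a relation `ge` : `f >_* g`. -/
def StrictGE {Ω : Type*} (ge : (Ω → ℝ) → (Ω → ℝ) → Prop) (f g : Ω → ℝ) : Prop :=
  ge f g ∧ ¬ ge g f

/-- `ge f g` (that is, `f ≥_* g`) is a criterion of collective rationality on real functions. -/
structure IsRationalOrder {Ω : Type*} (ge : (Ω → ℝ) → (Ω → ℝ) → Prop) : Prop where
  refl : ∀ f, ge f f
  trans : ∀ f g h, ge f g → ge g h → ge f h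
  one_gt_zero : StrictGE ge 1 0
  of_pointwise : ∀ f g : Ω → ℝ, (∀ ω, g ω ≤ f ω) → ge f g
  affine : ∀ f g : Ω → ℝ, ge f g → ∀ b h : Ω → ℝ, (∀ ω, 0 ≤ b ω) → (∃ K : ℝ, ∀ ω, b ω ≤ K) →
    ge (b * f + h) (b * g + h)
  trunc : ∀ f : Ω → ℝ, StrictGE ge f 0 → StrictGE ge (f ⊓ 1) 0

/-! ### Assets and prices -/

/-- The assumptions on the set `𝒳` of traded payoffs. It need not be a cone. -/
structure IsAssetSet {Ω : Type*} (ge : (Ω → ℝ) → (Ω → ℝ) → Prop) (𝒳 : Set (Ω → ℝ)) : Prop where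
  convex : Convex ℝ 𝒳
  zero_mem : (0 : Ω → ℝ) ∈ 𝒳
  one_mem : (1 : Ω → ℝ) ∈ 𝒳
  limited_loss : ∀ X ∈ 𝒳, ∃ a : ℝ, ge X (fun _ => a)
  add_const_mem : ∀ X ∈ 𝒳, ∀ c : ℝ, 0 ≤ c → (fun ω => X ω + c) ∈ 𝒳

/-- `π` is a price function on `𝒳`: positively homogeneous, subadditive (wherever the
payoffs concerned belong to `𝒳`), normalized, `≥_*`-monotone and free of arbitrage. -/
structure IsPriceFunction {Ω : Type*} (ge : (Ω → ℝ) → (Ω → ℝ) → Prop) (𝒳 : Set (Ω → ℝ))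
    (π : 𝒳 → ℝ) : Prop where
  pos_homogeneous : ∀ X Y : 𝒳, ∀ c : ℝ, 0 ≤ c → (Y : Ω → ℝ) = c • (X : Ω → ℝ) → π Y = c * π X
  subadditive : ∀ X Y Z : 𝒳, (Z : Ω → ℝ) = (X : Ω → ℝ) + (Y : Ω → ℝ) → π Z ≤ π X + π Y
  normalized : ∀ X : 𝒳, (X : Ω → ℝ) = 1 → π X = 1
  monotone : ∀ X Y : 𝒳, ge (X : Ω → ℝ) (Y : Ω → ℝ) → π Y ≤ π X
  no_arbitrage : ∀ X : 𝒳, StrictGE ge (X : Ω → ℝ) 0 → 0 < π X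

/-- The space `L(𝒳)` of functions `g` with `c X ≥_* |g|` for some `c > 0` and `X ∈ 𝒳`. -/
def superhedgeable {Ω : Type*} (ge : (Ω → ℝ) → (Ω → ℝ) → Prop) (𝒳 : Set (Ω → ℝ)) :
    Set (Ω → ℝ) :=
  {g | ∃ c : ℝ, 0 < c ∧ ∃ X ∈ 𝒳, ge (c • X) |g|}

/-- The set `𝒞(π)` of functions `g` with `c (X - π(X)) ≥_* g` for some `c > 0` and `X ∈ 𝒳`. -/
def priceCone {Ω : Type*} (ge : (Ω → ℝ) → (Ω → ℝ) → Prop) (𝒳 : Set (Ω → ℝ)) (π : 𝒳 → ℝ) :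
    Set (Ω → ℝ) :=
  {g | ∃ c : ℝ, 0 < c ∧ ∃ X : 𝒳, ge (fun ω => c * ((X : Ω → ℝ) ω - π X)) g}

/-! ### Finitely additive probabilities and the Dunford–Schwartz integral -/

/-- A finitely additive probability defined on all subsets of `Ω`. -/
structure FinAddProb (Ω : Type*) where
  toFun : Set Ω → ℝ
  nonneg : ∀ A, 0 ≤ toFun A
  add_of_disjoint : ∀ A B, Disjoint A B → toFun (A ∪ B) = toFun A + toFun B
  univ_eq_one : toFun Set.univ = 1

/-- Integral of a function with finitely many values (its value is used only for those). -/
noncomputable def simpleIntegral {Ω : Type*} (m : FinAddProb Ω) (s : Ω → ℝ) : ℝ :=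
  ∑ᶠ c : ℝ, c * m.toFun (s ⁻¹' {c})

/-- `f` is `m`-integrable with integral `I`: there is a sequence of simple functions that
converges to `f` in `m`-measure, is Cauchy in mean, and has integrals converging to `I`. -/
def HasIntegral {Ω : Type*} (m : FinAddProb Ω) (f : Ω → ℝ) (I : ℝ) : Prop :=
  ∃ s : ℕ → Ω → ℝ,
    (∀ n, (Set.range (s n)).Finite) ∧
    (∀ ε : ℝ, 0 < ε → Tendsto (fun n => m.toFun {ω | ε < |s n ω - f ω|}) atTop (𝓝 0)) ∧
    Tendsto (fun p : ℕ × ℕ => simpleIntegral m |s p.1 - s p.2|) atTop (𝓝 0) ∧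
    Tendsto (fun n => simpleIntegral m (s n)) atTop (𝓝 I)

/-- The space `L¹(m)` of `m`-integrable functions (functions, not equivalence classes). -/
def L1 {Ω : Type*} (m : FinAddProb Ω) : Set (Ω → ℝ) :=
  {f | ∃ I, HasIntegral m f I}

open Classical in
/-- The integral of `f` with respect to `m`, for `f ∈ L¹(m)`; zero otherwise. -/
noncomputable def integral {Ω : Type*} (m : FinAddProb Ω) (f : Ω → ℝ) : ℝ :=
  if h : ∃ I, HasIntegral m f I then h.choose else 0

/-- The set `ℳ₀(π)` of pricing measures. -/
def pricingMeasures {Ω : Type*} (ge : (Ω → ℝ) → (Ω → ℝ) → Prop) (𝒳 : Set (Ω → ℝ)) (π : 𝒳 → ℝ) :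
    Set (FinAddProb Ω) :=
  {m | superhedgeable ge 𝒳 ⊆ L1 m ∧ ∀ X : 𝒳, integral m (X : Ω → ℝ) ≤ π X}

/-! ### Closures -/

/-- Closure of a set of real functions in the topology of uniform distance. -/
def uniformClosure {Ω : Type*} (A : Set (Ω → ℝ)) : Set (Ω → ℝ) :=
  {f | UniformFun.ofFun f ∈ closure (UniformFun.ofFun '' A)}

/-- Closure of a set of real functions for the `L¹(m)` distance; the basic neighbourhoods of
`f` are the sets of all `h` with `f - h ∈ L¹(m)` and `∫ |f - h| dm < ε`. -/
def L1Closure {Ω : Type*} (m : FinAddProb Ω) (A : Set (Ω → ℝ)) : Set (Ω → ℝ) :=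
  {f | ∀ ε : ℝ, 0 < ε → ∃ h ∈ A, f - h ∈ L1 m ∧ integral m |f - h| < ε}

end FinAddMarket

namespace FinAddMarket

/-! ### Finitely additive probabilities and simple functions -/

section Simple

variable {Ω : Type*} (m : FinAddProb Ω)

/-! One direction is immediate: pricing measures have mass one, so the uniform closure lies in every
`L1Closure` (`uniformClosure_subset_L1Closure`).

For the other, let `f >_* 0` lie in all the `L1Closure`s. Its truncation `g = (f ∧ 1) ∨ 0` is still
strictly positive, so if the uniform closure contains no such function, some `g - ε` is outside the
cone. The gauge `p u = inf {t | u - t ∈ 𝒞(π)}` is finite and sublinear on `L(𝒳)` with `p g > 0`, and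
Hahn–Banach gives a linear `φ ≤ p` with `φ g = p g` and `φ 1 = 1`
(`exists_linearMap_of_sub_const_notMem`). Restricting `φ` to indicators yields a probability `m`. On
non-negative elements of `L(𝒳)` the integral is at most `φ` (`exists_hasIntegral_inducedProb_le`),
possibly strictly less. This inequality suffices for pricing, because the negative part of `X - a`
is negligible when `X ≥_* a`; on `g` it becomes an equality. Moreover `m` respects `≥_*`
(`exists_pricingMeasure`).

Finally pick `h ∈ 𝒞(π)` with `∫ |f - h| dm < ∫ g dm` and `c (X - π X) ≥_* h`. Integrating `c (X - π
X) + (f - h) ≥_* f ≥_* g` gives `∫ g dm ≤ ∫ |f - h| dm`, a contradiction. -/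

theorem FinAddProb.empty_eq_zero : m.toFun ∅ = 0 := by
  have h := m.add_of_disjoint ∅ ∅ (by simp)
  simp only [Set.union_self] at h
  linarith

theorem FinAddProb.mono {A B : Set Ω} (h : A ⊆ B) : m.toFun A ≤ m.toFun B := by
  have h1 := m.add_of_disjoint A (B \ A) Set.disjoint_sdiff_right
  rw [Set.union_sdiff_cancel h] at h1
  linarith [m.nonneg (B \ A)]

theorem FinAddProb.union_le (A B : Set Ω) : m.toFun (A ∪ B) ≤ m.toFun A + m.toFun B := by
  have h1 := m.add_of_disjoint A (B \ A) Set.disjoint_sdiff_right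
  rw [Set.union_sdiff_self] at h1
  linarith [m.mono (Set.sdiff_subset : B \ A ⊆ B)]

theorem FinAddProb.preimage_finset {β : Type*} (r : Ω → β) (S : Finset β) :
    m.toFun (r ⁻¹' (S : Set β)) = ∑ p ∈ S, m.toFun (r ⁻¹' {p}) := by
  classical
  induction S using Finset.induction_on with
  | empty => simp [m.empty_eq_zero]
  | insert a S ha ih =>
    rw [Finset.sum_insert ha, ← ih, ← m.add_of_disjoint]
    · congr 1
      ext ω
      simp
    · rw [Set.disjoint_left]
      rintro ω h1 h2
      simp only [Set.mem_preimage, Set.mem_singleton_iff, Finset.mem_coe] at h1 h2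
      exact ha (h1 ▸ h2)

/-- Any finite partition refining the level sets computes the integral. Taking `r = (s, t)` puts two
simple functions on a common partition, so linearity and monotonicity become facts about finite
sums. -/
theorem simpleIntegral_comp {β : Type*} (r : Ω → β) (hr : (Set.range r).Finite) (G : β → ℝ) :
    simpleIntegral m (fun ω => G (r ω)) = ∑ p ∈ hr.toFinset, G p * m.toFun (r ⁻¹' {p}) := by
  classical
  have hfib : ∀ c, m.toFun ((fun ω => G (r ω)) ⁻¹' {c})
      = ∑ p ∈ hr.toFinset with G p = c, m.toFun (r ⁻¹' {p}) := by
    intro c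
    rw [← m.preimage_finset]
    congr 1
    ext ω
    simp
  unfold simpleIntegral
  rw [finsum_eq_sum_of_support_subset (s := hr.toFinset.image G),
    ← Finset.sum_fiberwise_of_maps_to (g := G) (t := hr.toFinset.image G)
      (fun p hp => Finset.mem_image_of_mem G hp)]
  · refine Finset.sum_congr rfl fun c _ => ?_
    rw [hfib, Finset.mul_sum]
    refine Finset.sum_congr rfl fun p hp => ?_
    rw [(Finset.mem_filter.1 hp).2]
  · intro c hc
    by_contra hcon
    apply hc
    have : (fun ω => G (r ω)) ⁻¹' {c} = ∅ := by
      ext ω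
      simp only [Set.mem_preimage, Set.mem_singleton_iff, Set.mem_empty_iff_false, iff_false]
      intro h
      apply hcon
      simp only [Finset.coe_image, Set.Finite.coe_toFinset, Set.mem_image]
      exact ⟨r ω, ⟨ω, rfl⟩, h⟩
    simp [this, m.empty_eq_zero]

theorem finite_range_comp {β γ : Type*} {r : Ω → β} (hr : (Set.range r).Finite) (G : β → γ) :
    (Set.range fun ω => G (r ω)).Finite := by
  have := hr.image G
  rwa [← Set.range_comp] at this

theorem finite_range_pair {β γ : Type*} {s : Ω → β} {t : Ω → γ} (hs : (Set.range s).Finite)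
    (ht : (Set.range t).Finite) : (Set.range fun ω => (s ω, t ω)).Finite := by
  refine (hs.prod ht).subset ?_
  rintro _ ⟨ω, rfl⟩
  exact ⟨⟨ω, rfl⟩, ⟨ω, rfl⟩⟩

theorem finite_range_comp₂ {β γ δ : Type*} {s : Ω → β} {t : Ω → γ} (hs : (Set.range s).Finite)
    (ht : (Set.range t).Finite) (G : β → γ → δ) : (Set.range fun ω => G (s ω) (t ω)).Finite :=
  finite_range_comp (finite_range_pair hs ht) fun p => G p.1 p.2

theorem simpleIntegral_add {s t : Ω → ℝ} (hs : (Set.range s).Finite) (ht : (Set.range t).Finite) :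
    simpleIntegral m (s + t) = simpleIntegral m s + simpleIntegral m t := by
  have h := finite_range_pair hs ht
  have h1 := simpleIntegral_comp m _ h fun p => p.1 + p.2
  have h2 := simpleIntegral_comp m _ h fun p => p.1
  have h3 := simpleIntegral_comp m _ h fun p => p.2
  simp only [add_mul, Finset.sum_add_distrib] at h1
  rw [← h2, ← h3] at h1
  exact h1

theorem simpleIntegral_smul (c : ℝ) {s : Ω → ℝ} (hs : (Set.range s).Finite) :
    simpleIntegral m (c • s) = c * simpleIntegral m s := by
  have h1 := simpleIntegral_comp m _ hs fun p => c * p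
  have h2 := simpleIntegral_comp m _ hs fun p => p
  simp only [mul_assoc, ← Finset.mul_sum] at h1
  rw [← h2] at h1
  exact h1

theorem simpleIntegral_mono {s t : Ω → ℝ} (hs : (Set.range s).Finite) (ht : (Set.range t).Finite)
    (hst : ∀ ω, s ω ≤ t ω) : simpleIntegral m s ≤ simpleIntegral m t := by
  have h := finite_range_pair hs ht
  have h2 := simpleIntegral_comp m _ h fun p => p.1
  have h3 := simpleIntegral_comp m _ h fun p => p.2
  calc simpleIntegral m s = _ := h2
    _ ≤ _ := ?_
    _ = simpleIntegral m t := h3.symm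
  refine Finset.sum_le_sum fun p hp => mul_le_mul_of_nonneg_right ?_ (m.nonneg _)
  obtain ⟨ω, rfl⟩ := h.mem_toFinset.1 hp
  exact hst ω

theorem finite_range_indicator (A : Set Ω) (c : ℝ) :
    (Set.range (A.indicator fun _ => c)).Finite := by
  refine (Set.toFinite {0, c}).subset ?_
  rintro _ ⟨ω, rfl⟩
  by_cases h : ω ∈ A <;> simp [h]

theorem simpleIntegral_indicator (A : Set Ω) (c : ℝ) :
    simpleIntegral m (A.indicator fun _ => c) = c * m.toFun A := by
  classical
  -- For `c = 0` the level set of `c` is all of `Ω` rather than `A`.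
  by_cases hc : c = 0
  · subst hc
    rw [Set.indicator_zero, zero_mul]
    have h := simpleIntegral_smul m 0 (finite_range_indicator A 0)
    rw [zero_smul, zero_mul] at h
    exact h
  unfold simpleIntegral
  rw [finsum_eq_single _ c]
  · congr 2
    ext ω
    by_cases h : ω ∈ A <;> simp [h, Ne.symm hc]
  · intro x hx
    by_cases h0 : x = 0
    · simp [h0]
    · have : (A.indicator fun _ => c) ⁻¹' {x} = ∅ := by
        ext ω
        by_cases h : ω ∈ A <;> simp [h, Ne.symm hx, Ne.symm h0]
      simp [this, m.empty_eq_zero]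

theorem simpleIntegral_const (c : ℝ) : simpleIntegral m (fun _ => c) = c := by
  have := simpleIntegral_indicator m Set.univ c
  simpa [m.univ_eq_one] using this

theorem simpleIntegral_nonneg {s : Ω → ℝ} (hs : (Set.range s).Finite) (h : ∀ ω, 0 ≤ s ω) :
    0 ≤ simpleIntegral m s :=
  (simpleIntegral_const m 0).symm.le.trans
    (simpleIntegral_mono m Set.finite_range_const hs h)

theorem finite_range_abs_sub {s t : Ω → ℝ} (hs : (Set.range s).Finite)
    (ht : (Set.range t).Finite) : (Set.range |s - t|).Finite :=
  finite_range_comp₂ hs ht fun x y => |x - y|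

theorem simpleIntegral_abs_sub_nonneg {s t : Ω → ℝ} (hs : (Set.range s).Finite)
    (ht : (Set.range t).Finite) : 0 ≤ simpleIntegral m |s - t| :=
  simpleIntegral_nonneg m (finite_range_abs_sub hs ht) fun _ => abs_nonneg _

theorem simpleIntegral_sub_le {s t : Ω → ℝ} (hs : (Set.range s).Finite)
    (ht : (Set.range t).Finite) :
    simpleIntegral m s - simpleIntegral m t ≤ simpleIntegral m |s - t| := by
  have h := simpleIntegral_mono m hs (t := t + |s - t|)
    (finite_range_comp₂ ht (finite_range_abs_sub hs ht) fun x y => x + y) fun ω => by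
      simp only [Pi.add_apply, Pi.abs_apply, Pi.sub_apply]
      linarith [le_abs_self (s ω - t ω)]
  rw [simpleIntegral_add m ht (finite_range_abs_sub hs ht)] at h
  linarith

theorem abs_simpleIntegral_sub_le {s t : Ω → ℝ} (hs : (Set.range s).Finite)
    (ht : (Set.range t).Finite) :
    |simpleIntegral m s - simpleIntegral m t| ≤ simpleIntegral m |s - t| := by
  rw [abs_le]
  have h := simpleIntegral_sub_le m ht hs
  rw [abs_sub_comm] at h
  exact ⟨by linarith, simpleIntegral_sub_le m hs ht⟩

theorem exists_abs_le_of_finite_range {s : Ω → ℝ} (hs : (Set.range s).Finite) :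
    ∃ K, 0 ≤ K ∧ ∀ ω, |s ω| ≤ K := by
  obtain ⟨K, hK⟩ := (finite_range_comp hs fun x => |x|).bddAbove
  exact ⟨max K 0, le_max_right _ _, fun ω => (hK ⟨ω, rfl⟩).trans (le_max_left _ _)⟩

/-- Mean-Cauchy sequences of simple functions that vanish in measure vanish in mean. -/
theorem tendsto_simpleIntegral_abs_zero {r : ℕ → Ω → ℝ} (hr : ∀ n, (Set.range (r n)).Finite)
    (hmeas : ∀ ε : ℝ, 0 < ε → Tendsto (fun n => m.toFun {ω | ε < |r n ω|}) atTop (𝓝 0))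
    (hcau : Tendsto (fun p : ℕ × ℕ => simpleIntegral m |r p.1 - r p.2|) atTop (𝓝 0)) :
    Tendsto (fun n => simpleIntegral m |r n|) atTop (𝓝 0) := by
  have habs : ∀ n, (Set.range |r n|).Finite := fun n => finite_range_comp (hr n) fun x => |x|
  rw [Metric.tendsto_atTop]
  intro ε hε
  have hev := hcau.eventually (gt_mem_nhds (show (0 : ℝ) < ε / 4 by linarith))
  rw [eventually_atTop] at hev
  obtain ⟨⟨N₁, N₂⟩, hN⟩ := hev
  set N := max N₁ N₂
  obtain ⟨K, hK0, hK⟩ := exists_abs_le_of_finite_range (hr N)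
  have hev2 := ((hmeas (ε / 4) (by linarith)).const_mul K).eventually
    (gt_mem_nhds (show K * 0 < ε / 4 by linarith))
  rw [eventually_atTop] at hev2
  obtain ⟨M, hM⟩ := hev2
  refine ⟨max N M, fun n hn => ?_⟩
  have hn1 : simpleIntegral m |r n - r N| < ε / 4 :=
    hN (n, N) ⟨(le_max_left _ _).trans ((le_max_left _ _).trans hn), le_max_right _ _⟩
  have hn2 := hM n ((le_max_right _ _).trans hn)
  set A := {ω | ε / 4 < |r n ω|}
  have hfin := finite_range_abs_sub (hr n) (hr N)
  have hfc : (Set.range fun _ : Ω => ε / 4).Finite := Set.finite_range_const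
  have hfi := finite_range_indicator A K
  have h12 : (Set.range (|r n - r N| + fun _ => ε / 4)).Finite :=
    finite_range_comp₂ hfin hfc fun x y => x + y
  -- On `A` compare `r n` with the fixed `r N`, bounded by `K`; off `A` it is at most `ε / 4`. Since
  -- `N` is fixed first, `K` does not depend on `n`.
  have key := simpleIntegral_mono m (habs n)
    (t := (|r n - r N| + fun _ => ε / 4) + A.indicator fun _ => K)
    (finite_range_comp₂ h12 hfi fun x y => x + y) fun ω => by
      simp only [Pi.add_apply, Pi.abs_apply, Pi.sub_apply]
      by_cases hω : ω ∈ A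
      · rw [Set.indicator_of_mem hω]
        have := abs_add_le (r n ω - r N ω) (r N ω)
        rw [sub_add_cancel] at this
        linarith [hK ω]
      · rw [Set.indicator_of_notMem hω]
        have : |r n ω| ≤ ε / 4 := not_lt.1 hω
        linarith [abs_nonneg (r n ω - r N ω)]
  rw [simpleIntegral_add m h12 hfi, simpleIntegral_add m hfin hfc, simpleIntegral_const,
    simpleIntegral_indicator] at key
  have h0 : 0 ≤ simpleIntegral m |r n| :=
    simpleIntegral_nonneg m (habs n) fun _ => abs_nonneg _
  rw [Real.dist_eq, sub_zero, abs_of_nonneg h0]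
  linarith

end Simple

/-! ### The Dunford–Schwartz integral -/

section Integral

variable {Ω : Type*} {m : FinAddProb Ω}

/-- Mean-Cauchy sequences have Cauchy integrals, so the last clause of `HasIntegral` only names the
limit. -/
theorem exists_hasIntegral {f : Ω → ℝ} {s : ℕ → Ω → ℝ} (hs : ∀ n, (Set.range (s n)).Finite)
    (hmeas : ∀ ε : ℝ, 0 < ε → Tendsto (fun n => m.toFun {ω | ε < |s n ω - f ω|}) atTop (𝓝 0))
    (hcau : Tendsto (fun p : ℕ × ℕ => simpleIntegral m |s p.1 - s p.2|) atTop (𝓝 0)) :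
    ∃ I, HasIntegral m f I ∧ Tendsto (fun n => simpleIntegral m (s n)) atTop (𝓝 I) := by
  have : CauchySeq fun n => simpleIntegral m (s n) := by
    rw [cauchySeq_iff_tendsto_dist_atTop_0]
    exact squeeze_zero (fun _ => dist_nonneg)
      (fun p => abs_simpleIntegral_sub_le m (hs p.1) (hs p.2)) hcau
  obtain ⟨I, hI⟩ := cauchySeq_tendsto_of_complete this
  exact ⟨I, ⟨s, hs, hmeas, hcau, hI⟩, hI⟩

theorem HasIntegral.add {f g : Ω → ℝ} {I J : ℝ} (hf : HasIntegral m f I)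
    (hg : HasIntegral m g J) : HasIntegral m (f + g) (I + J) := by
  obtain ⟨s, hs, hsm, hsc, hsI⟩ := hf
  obtain ⟨t, ht, htm, htc, htJ⟩ := hg
  have hst : ∀ n, (Set.range (s n + t n)).Finite :=
    fun n => finite_range_comp₂ (hs n) (ht n) fun x y => x + y
  refine ⟨fun n => s n + t n, hst, fun ε hε => ?_, ?_, ?_⟩
  · have h := (hsm (ε / 2) (by linarith)).add (htm (ε / 2) (by linarith))
    rw [add_zero] at h
    refine squeeze_zero (fun _ => m.nonneg _) (fun n => ?_) h
    refine (m.mono ?_).trans (m.union_le _ _)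
    intro ω hω
    by_contra hcon
    simp only [Set.mem_union, Set.mem_ofPred_eq, not_or, not_lt, Pi.add_apply] at hcon hω
    have := abs_add_le (s n ω - f ω) (t n ω - g ω)
    rw [show s n ω - f ω + (t n ω - g ω) = s n ω + t n ω - (f ω + g ω) by ring] at this
    linarith [hcon.1, hcon.2]
  · have h := hsc.add htc
    rw [add_zero] at h
    refine squeeze_zero (fun p => simpleIntegral_abs_sub_nonneg m (hst _) (hst _))
      (fun p => ?_) h
    have h1 := finite_range_abs_sub (hs p.1) (hs p.2)
    have h2 := finite_range_abs_sub (ht p.1) (ht p.2)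
    rw [← simpleIntegral_add m h1 h2]
    refine simpleIntegral_mono m (finite_range_abs_sub (hst _) (hst _))
      (finite_range_comp₂ h1 h2 fun x y => x + y) fun ω => ?_
    simp only [Pi.add_apply, Pi.abs_apply, Pi.sub_apply]
    rw [add_sub_add_comm]
    exact abs_add_le _ _
  · simpa only [simpleIntegral_add m (hs _) (ht _)] using hsI.add htJ

/-- Composition with a Lipschitz function preserves approximability by simple functions. -/
theorem approx_comp {f : Ω → ℝ} {s : ℕ → Ω → ℝ} (hs : ∀ n, (Set.range (s n)).Finite)
    (hsm : ∀ ε : ℝ, 0 < ε → Tendsto (fun n => m.toFun {ω | ε < |s n ω - f ω|}) atTop (𝓝 0))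
    (hsc : Tendsto (fun p : ℕ × ℕ => simpleIntegral m |s p.1 - s p.2|) atTop (𝓝 0))
    {G : ℝ → ℝ} {K : ℝ} (hK : 0 < K) (hG : ∀ x y, |G x - G y| ≤ K * |x - y|) :
    (∀ n, (Set.range fun ω => G (s n ω)).Finite) ∧
    (∀ ε : ℝ, 0 < ε →
      Tendsto (fun n => m.toFun {ω | ε < |G (s n ω) - G (f ω)|}) atTop (𝓝 0)) ∧
    Tendsto (fun p : ℕ × ℕ => simpleIntegral m
      |(fun ω => G (s p.1 ω)) - (fun ω => G (s p.2 ω))|) atTop (𝓝 0) := by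
  have hfin : ∀ n, (Set.range fun ω => G (s n ω)).Finite := fun n => finite_range_comp (hs n) G
  refine ⟨hfin, fun ε hε => ?_, ?_⟩
  · refine squeeze_zero (fun _ => m.nonneg _) (fun n => m.mono ?_) (hsm (ε / K) (by positivity))
    intro ω hω
    simp only [Set.mem_ofPred_eq] at hω ⊢
    rw [div_lt_iff₀' hK]
    exact hω.trans_le (hG _ _)
  · have h := hsc.const_mul K
    rw [mul_zero] at h
    refine squeeze_zero (fun p => simpleIntegral_abs_sub_nonneg m (hfin _) (hfin _))
      (fun p => ?_) h
    have h1 := finite_range_abs_sub (hs p.1) (hs p.2)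
    rw [← simpleIntegral_smul m K h1]
    exact simpleIntegral_mono m (finite_range_abs_sub (hfin _) (hfin _))
      (finite_range_comp h1 fun x => K * x) fun ω => hG _ _

theorem HasIntegral.const_smul {f : Ω → ℝ} {I : ℝ} (hf : HasIntegral m f I) (c : ℝ) :
    HasIntegral m (c • f) (c * I) := by
  obtain ⟨s, hs, hsm, hsc, hsI⟩ := hf
  obtain ⟨h1, h2, h3⟩ := approx_comp (G := fun x => c * x) (K := |c| + 1) hs hsm hsc
    (by positivity) fun x y => by
      rw [← mul_sub, abs_mul]
      nlinarith [abs_nonneg (x - y)]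
  refine ⟨fun n => c • s n, h1, h2, h3, ?_⟩
  simpa only [simpleIntegral_smul m c (hs _)] using hsI.const_mul c

theorem HasIntegral.sub {f g : Ω → ℝ} {I J : ℝ} (hf : HasIntegral m f I)
    (hg : HasIntegral m g J) : HasIntegral m (f - g) (I - J) := by
  have := hf.add (hg.const_smul (-1))
  simpa [sub_eq_add_neg] using this

/-- An integrable function that is non-negative up to null sets has non-negative integral. -/
theorem HasIntegral.nonneg_of_null {f : Ω → ℝ} {I : ℝ} (hf : HasIntegral m f I)
    (hnull : ∀ δ : ℝ, 0 < δ → m.toFun {ω | f ω < -δ} = 0) : 0 ≤ I := by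
  obtain ⟨s, hs, hsm, hsc, hsI⟩ := hf
  -- The negative parts of the approximants are mean-Cauchy and vanish in measure, hence vanish in
  -- mean; adding them to `s n` makes it non-negative without changing the limit.
  obtain ⟨h1, h2, h3⟩ := approx_comp (G := fun x => max (-x) 0) (K := 1) hs hsm hsc
    one_pos fun x y => by
      have := abs_max_sub_max_le_abs (-x) (-y) 0
      rwa [neg_sub_neg, abs_sub_comm y x, ← one_mul |x - y|] at this
  have h4 := tendsto_simpleIntegral_abs_zero m h1 (fun ε hε => by
    have h := (h2 (ε / 2) (by linarith))
    refine squeeze_zero (fun _ => m.nonneg _) (fun n => ?_) h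
    have hunion := m.union_le {ω | ε / 2 < |max (-s n ω) 0 - max (-f ω) 0|} {ω | f ω < -(ε / 2)}
    rw [hnull (ε / 2) (by linarith), add_zero] at hunion
    refine (m.mono ?_).trans hunion
    intro ω hω
    by_contra hcon
    simp only [Set.mem_union, Set.mem_ofPred_eq, not_or, not_lt] at hcon hω
    have h5 : max (-f ω) 0 ≤ ε / 2 := max_le (by linarith) (by linarith)
    rw [abs_of_nonneg (le_max_right _ _)] at hω
    linarith [(abs_le.1 hcon.1).2]) h3
  refine ge_of_tendsto' (hsI.add h4 |>.congr fun n => rfl) (fun n => ?_) |>.trans_eq (add_zero I)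
  have habs : (Set.range |fun ω => max (-s n ω) 0|).Finite :=
    finite_range_comp (h1 n) fun x => |x|
  rw [← simpleIntegral_add m (hs n) habs]
  refine simpleIntegral_nonneg m
    (finite_range_comp₂ (hs n) habs fun x y => x + y) fun ω => ?_
  simp only [Pi.add_apply, Pi.abs_apply]
  linarith [le_abs_self (max (-s n ω) 0), le_max_left (-s n ω) 0]

theorem HasIntegral.mono {f g : Ω → ℝ} {I J : ℝ} (hf : HasIntegral m f I)
    (hg : HasIntegral m g J) (h : ∀ ω, f ω ≤ g ω) : I ≤ J := by
  refine sub_nonneg.1 ((hg.sub hf).nonneg_of_null fun δ hδ => ?_)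
  convert m.empty_eq_zero
  ext ω
  simp only [Pi.sub_apply, Set.mem_ofPred_eq, Set.mem_empty_iff_false, iff_false, not_lt]
  linarith [h ω]

/-- Makes the choice in `integral` independent of the approximating sequence. -/
theorem HasIntegral.unique {f : Ω → ℝ} {I J : ℝ} (hI : HasIntegral m f I)
    (hJ : HasIntegral m f J) : I = J :=
  le_antisymm (hI.mono hJ fun _ => le_rfl) (hJ.mono hI fun _ => le_rfl)

theorem HasIntegral.integral_eq {f : Ω → ℝ} {I : ℝ} (hI : HasIntegral m f I) :
    integral m f = I := by
  have h : ∃ I, HasIntegral m f I := ⟨I, hI⟩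
  rw [integral, dif_pos h]
  exact h.choose_spec.unique hI

theorem hasIntegral_integral {f : Ω → ℝ} (hf : f ∈ L1 m) : HasIntegral m f (integral m f) := by
  obtain ⟨I, hI⟩ := hf
  rwa [hI.integral_eq]

theorem hasIntegral_of_finite_range {s : Ω → ℝ} (hs : (Set.range s).Finite) :
    HasIntegral m s (simpleIntegral m s) := by
  refine ⟨fun _ => s, fun _ => hs, fun ε hε => ?_, ?_, tendsto_const_nhds⟩
  · simp [hε.not_gt, m.empty_eq_zero]
  · simp only [sub_self, abs_zero]
    exact tendsto_const_nhds.congr fun _ => (simpleIntegral_const m 0).symm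

theorem hasIntegral_const (c : ℝ) : HasIntegral m (fun _ => c) c := by
  have := hasIntegral_of_finite_range (m := m) (s := fun _ => c) Set.finite_range_const
  rwa [simpleIntegral_const] at this

theorem abs_mem_L1 {f : Ω → ℝ} (hf : f ∈ L1 m) : |f| ∈ L1 m := by
  obtain ⟨_, s, hs, hsm, hsc, -⟩ := hf
  obtain ⟨h1, h2, h3⟩ := approx_comp (G := fun x => |x|) (K := 1) hs hsm hsc one_pos
    fun x y => by
      rw [one_mul]
      exact abs_abs_sub_abs_le_abs_sub x y
  obtain ⟨I, hI, -⟩ := exists_hasIntegral (f := |f|) h1 h2 h3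
  exact ⟨I, hI⟩

end Integral

/-! ### Integration against the measure induced by a positive functional -/

section Functional

variable {Ω : Type*}

/-- The set function induced on events by a normalized linear functional that is non-negative
on bounded non-negative functions. -/
noncomputable def inducedProb (φ : (Ω → ℝ) →ₗ[ℝ] ℝ)
    (hpos : ∀ u : Ω → ℝ, (∀ ω, 0 ≤ u ω) → (∃ K : ℝ, ∀ ω, u ω ≤ K) → 0 ≤ φ u)
    (hone : φ (fun _ => 1) = 1) : FinAddProb Ω where
  toFun A := φ (A.indicator fun _ => 1)
  nonneg A := hpos _ (fun ω => Set.indicator_nonneg (fun _ _ => zero_le_one) ω)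
    ⟨1, fun ω => Set.indicator_le_self' (fun _ _ => zero_le_one) ω⟩
  add_of_disjoint A B h := by rw [Set.indicator_union_of_disjoint h, ← map_add]; rfl
  univ_eq_one := by rw [Set.indicator_univ, hone]

variable {φ : (Ω → ℝ) →ₗ[ℝ] ℝ}
  {hpos : ∀ u : Ω → ℝ, (∀ ω, 0 ≤ u ω) → (∃ K : ℝ, ∀ ω, u ω ≤ K) → 0 ≤ φ u}
  {hone : φ (fun _ => 1) = 1}

theorem simpleIntegral_inducedProb {s : Ω → ℝ} (hs : (Set.range s).Finite) :
    simpleIntegral (inducedProb φ hpos hone) s = φ s := by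
  have h1 := simpleIntegral_comp (inducedProb φ hpos hone) s hs fun x => x
  have h2 : s = ∑ c ∈ hs.toFinset, c • (s ⁻¹' {c}).indicator fun _ => (1 : ℝ) := by
    ext ω
    rw [Finset.sum_apply, Finset.sum_eq_single (s ω)]
    · simp
    · intro c _ hc
      simp [Ne.symm hc]
    · intro h
      exact absurd (hs.mem_toFinset.2 ⟨ω, rfl⟩) h
  conv_rhs => rw [h2]
  rw [map_sum]
  simp only [map_smul, smul_eq_mul]
  exact h1

/-- Approximation of a non-negative function from below by simple functions. -/
noncomputable def simpleApprox (f : Ω → ℝ) (n : ℕ) (ω : Ω) : ℝ :=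
  -- `min f (n + 1)` rounded down to the mesh `1 / (n + 1)`.
  ((min ⌊((n : ℝ) + 1) * f ω⌋₊ ((n + 1) * (n + 1)) : ℕ) : ℝ) / ((n : ℝ) + 1)

theorem finite_range_simpleApprox (f : Ω → ℝ) (n : ℕ) : (Set.range (simpleApprox f n)).Finite := by
  have h : (Set.range fun ω => min ⌊((n : ℝ) + 1) * f ω⌋₊ ((n + 1) * (n + 1))).Finite := by
    refine (Set.finite_Iic ((n + 1) * (n + 1))).subset ?_
    rintro _ ⟨ω, rfl⟩
    exact Set.mem_Iic.2 (min_le_right _ _)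
  exact finite_range_comp h fun k => (k : ℝ) / ((n : ℝ) + 1)

theorem simpleApprox_nonneg (f : Ω → ℝ) (n : ℕ) (ω : Ω) : 0 ≤ simpleApprox f n ω := by
  unfold simpleApprox
  positivity

theorem simpleApprox_le_min {f : Ω → ℝ} (hf : ∀ ω, 0 ≤ f ω) (n : ℕ) (ω : Ω) :
    simpleApprox f n ω ≤ min (f ω) (n + 1) := by
  have hn : (0 : ℝ) < (n : ℝ) + 1 := by positivity
  unfold simpleApprox
  push_cast
  rw [div_le_iff₀ hn, min_mul_of_nonneg _ _ hn.le]
  refine min_le_min ?_ le_rfl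
  rw [mul_comm (f ω)]
  exact Nat.floor_le (mul_nonneg hn.le (hf ω))

theorem min_le_simpleApprox_add (f : Ω → ℝ) (n : ℕ) (ω : Ω) :
    min (f ω) (n + 1) ≤ simpleApprox f n ω + 1 / ((n : ℝ) + 1) := by
  have hn : (0 : ℝ) < (n : ℝ) + 1 := by positivity
  unfold simpleApprox
  push_cast
  rw [← add_div, le_div_iff₀ hn, min_mul_of_nonneg _ _ hn.le, ← min_add_add_right]
  refine min_le_min ?_ (by linarith)
  rw [mul_comm (f ω)]
  exact (Nat.lt_floor_add_one _).le

/-- A non-negative function whose truncations are dominated by `φ f` is integrable, with integral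
at most `φ f`. -/
theorem exists_hasIntegral_inducedProb_le {f : Ω → ℝ} (hf : ∀ ω, 0 ≤ f ω)
    (hφ : ∀ u : Ω → ℝ, (∀ ω, 0 ≤ u ω) → (∀ ω, u ω ≤ f ω) → (∃ K : ℝ, ∀ ω, u ω ≤ K) →
      φ u ≤ φ f) :
    ∃ I ≤ φ f, HasIntegral (inducedProb φ hpos hone) f I := by
  set m := inducedProb φ hpos hone
  set s := simpleApprox f
  have hs := finite_range_simpleApprox f
  have hs0 := simpleApprox_nonneg f
  have hsle := simpleApprox_le_min hf
  have hles := min_le_simpleApprox_add f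
  have hinv : Tendsto (fun n : ℕ => 1 / ((n : ℝ) + 1)) atTop (𝓝 0) :=
    tendsto_one_div_add_atTop_nhds_zero_nat
  have hconst : ∀ c : ℝ, φ (fun _ => c) = c := fun c => by
    have h : (fun _ : Ω => c) = c • fun _ => (1 : ℝ) := by ext; simp
    rw [h, map_smul, hone, smul_eq_mul, mul_one]
  let g : ℕ → Ω → ℝ := fun n ω => min (f ω) (n + 1)
  have hg0 : ∀ n ω, 0 ≤ g n ω := fun n ω => le_min (hf ω) (by positivity)
  have hgmono : Monotone g := fun n k hnk ω => by
    have : (n : ℝ) ≤ k := by exact_mod_cast hnk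
    exact min_le_min le_rfl (by linarith)
  have hamono : Monotone fun n => φ (g n) := fun n k hnk => by
    rw [← sub_nonneg, ← map_sub]
    refine hpos _ (fun ω => sub_nonneg.2 (hgmono hnk ω)) ⟨k + 1, fun ω => ?_⟩
    have : g k ω ≤ k + 1 := min_le_right _ _
    simp only [Pi.sub_apply]
    linarith [hg0 n ω]
  -- The values `φ (g n)` increase and are bounded by `φ f`; their Cauchy property passes to `s n`,
  -- which is within `1 / (n + 1)` of `g n`.
  have hacau : Tendsto (fun p : ℕ × ℕ => |φ (g p.1) - φ (g p.2)|) atTop (𝓝 0) := by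
    have hc := (tendsto_atTop_ciSup hamono ⟨φ f, by
      rintro _ ⟨n, rfl⟩
      exact hφ _ (hg0 n) (fun ω => min_le_left _ _) ⟨n + 1, fun ω => min_le_right _ _⟩⟩).cauchySeq
    exact cauchySeq_iff_tendsto_dist_atTop_0.1 hc
  have hbound : ∀ n k, k ≤ n → simpleIntegral m |s n - s k| ≤
      |φ (g n) - φ (g k)| + (1 / ((n : ℝ) + 1) + 1 / ((k : ℝ) + 1)) := by
    intro n k hkn
    rw [simpleIntegral_inducedProb (finite_range_abs_sub (hs n) (hs k))]
    have h1 : 0 ≤ φ ((g n - g k) + (fun _ => 1 / ((n : ℝ) + 1) + 1 / ((k : ℝ) + 1))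
        - |s n - s k|) := by
      refine hpos _ (fun ω => ?_)
        ⟨(n + 1) + (1 / ((n : ℝ) + 1) + 1 / ((k : ℝ) + 1)), fun ω => ?_⟩
      · simp only [Pi.add_apply, Pi.abs_apply, Pi.sub_apply]
        rw [sub_nonneg, abs_le]
        have hn := hsle n ω
        have hk := hsle k ω
        have hn' := hles n ω
        have hk' := hles k ω
        have hgk := hgmono hkn ω
        have hn0 : 0 ≤ 1 / ((n : ℝ) + 1) := by positivity
        have hk0 : 0 ≤ 1 / ((k : ℝ) + 1) := by positivity
        simp only [g, s] at *
        constructor <;> linarith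
      · simp only [Pi.add_apply, Pi.abs_apply, Pi.sub_apply]
        have : g n ω ≤ n + 1 := min_le_right _ _
        linarith [hg0 k ω, abs_nonneg (s n ω - s k ω)]
    rw [map_sub, map_add, map_sub, hconst] at h1
    linarith [le_abs_self (φ (g n) - φ (g k))]
  have hbound' : ∀ n k, simpleIntegral m |s n - s k| ≤
      |φ (g n) - φ (g k)| + (1 / ((n : ℝ) + 1) + 1 / ((k : ℝ) + 1)) := by
    intro n k
    rcases le_total k n with h | h
    · exact hbound n k h
    · rw [abs_sub_comm, abs_sub_comm (φ (g n)), add_comm (1 / ((n : ℝ) + 1))]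
      exact hbound k n h
  have hcau : Tendsto (fun p : ℕ × ℕ => simpleIntegral m |s p.1 - s p.2|) atTop (𝓝 0) := by
    rw [← prod_atTop_atTop_eq] at hacau ⊢
    have h := hacau.add ((hinv.comp tendsto_fst).add (hinv.comp tendsto_snd))
    rw [add_zero, add_zero] at h
    exact squeeze_zero (fun p => simpleIntegral_abs_sub_nonneg m (hs _) (hs _))
      (fun p => hbound' p.1 p.2) h
  -- Chebyshev: once `1 / (n + 1) < ε`, an error above `ε` occurs only where `f ≥ n + 1`, a set of
  -- measure at most `φ f / (n + 1)`.
  have hmeas : ∀ ε : ℝ, 0 < ε →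
      Tendsto (fun n => m.toFun {ω | ε < |s n ω - f ω|}) atTop (𝓝 0) := by
    intro ε hε
    have h := hinv.const_mul (φ f)
    rw [mul_zero] at h
    refine squeeze_zero' (Eventually.of_forall fun _ => m.nonneg _) ?_ h
    filter_upwards [hinv.eventually (gt_mem_nhds hε)] with n hn
    have hn0 : (0 : ℝ) < (n : ℝ) + 1 := by positivity
    rw [mul_one_div, le_div_iff₀ hn0]
    have h2 := hφ (((n : ℝ) + 1) • {ω | ε < |s n ω - f ω|}.indicator fun _ => (1 : ℝ))
      (fun ω => mul_nonneg hn0.le (Set.indicator_nonneg (fun _ _ => zero_le_one) ω))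
      (fun ω => ?_)
      ⟨(n : ℝ) + 1, fun ω => mul_le_of_le_one_right hn0.le
        (Set.indicator_le_self' (fun _ _ => zero_le_one) ω)⟩
    · rw [map_smul, smul_eq_mul, mul_comm] at h2
      exact h2
    · by_cases hω : ω ∈ {ω | ε < |s n ω - f ω|}
      · simp only [Pi.smul_apply, Set.indicator_of_mem hω, smul_eq_mul, mul_one]
        by_contra! hlt
        have h3 := hles n ω
        have h4 := hsle n ω
        rw [min_eq_left hlt.le] at h3 h4
        have h5 : ε < |s n ω - f ω| := hω
        rw [abs_sub_comm, abs_of_nonneg (sub_nonneg.2 h4)] at h5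
        linarith
      · simp only [Pi.smul_apply, Set.indicator_of_notMem hω, smul_zero]
        exact hf ω
  obtain ⟨I, hI, hlim⟩ := exists_hasIntegral hs hmeas hcau
  refine ⟨I, le_of_tendsto' hlim fun n => ?_, hI⟩
  rw [simpleIntegral_inducedProb (hs n)]
  exact hφ _ (hs0 n) (fun ω => (hsle n ω).trans (min_le_left _ _))
    ⟨n + 1, fun ω => (hsle n ω).trans (min_le_right _ _)⟩

end Functional

/-! ### Rational orders -/

section Order

variable {Ω : Type*} {ge : (Ω → ℝ) → (Ω → ℝ) → Prop}

theorem IsRationalOrder.add_right (h : IsRationalOrder ge) {f g : Ω → ℝ} (hfg : ge f g)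
    (k : Ω → ℝ) : ge (f + k) (g + k) := by
  simpa using h.affine f g hfg 1 k (fun _ => zero_le_one) ⟨1, fun _ => le_rfl⟩

theorem IsRationalOrder.add (h : IsRationalOrder ge) {f g f' g' : Ω → ℝ} (hfg : ge f g)
    (hfg' : ge f' g') : ge (f + f') (g + g') := by
  have h2 := h.add_right hfg' g
  rw [add_comm f', add_comm g'] at h2
  exact h.trans _ _ _ (h.add_right hfg f') h2

theorem IsRationalOrder.smul (h : IsRationalOrder ge) {f g : Ω → ℝ} (hfg : ge f g) {c : ℝ}
    (hc : 0 ≤ c) : ge (c • f) (c • g) := by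
  have h1 := h.affine f g hfg (fun _ => c) 0 (fun _ => hc) ⟨c, fun _ => le_rfl⟩
  rw [add_zero, add_zero] at h1
  exact h1

theorem IsRationalOrder.sub_nonneg (h : IsRationalOrder ge) {f g : Ω → ℝ} (hfg : ge f g) :
    ge (f - g) 0 := by
  simpa [sub_eq_add_neg] using h.add_right hfg (-g)

/-- Multiply `f ≥_* 0` by the indicator of `{f < 0}` and add the negative part. -/
theorem IsRationalOrder.zero_ge_negPart (h : IsRationalOrder ge) {f : Ω → ℝ} (hf : ge f 0) :
    ge 0 (fun ω => max (-f ω) 0) := by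
  classical
  have h1 := h.affine f 0 hf ({ω | f ω < 0}.indicator fun _ => 1) (fun ω => max (-f ω) 0)
    (fun ω => Set.indicator_nonneg (fun _ _ => zero_le_one) ω)
    ⟨1, fun ω => Set.indicator_le_self' (fun _ _ => zero_le_one) ω⟩
  rw [mul_zero, zero_add] at h1
  convert h1 using 1
  ext ω
  by_cases hω : f ω < 0
  · simp [hω, hω.le]
  · simp [hω, not_lt.1 hω]

theorem IsRationalOrder.ge_posPart (h : IsRationalOrder ge) {f : Ω → ℝ} (hf : ge f 0) :
    ge f (fun ω => max (f ω) 0) := by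
  convert h.add_right (h.zero_ge_negPart hf) f using 1
  · simp
  · ext ω
    simp only [Pi.add_apply]
    rcases le_total (f ω) 0 with hω | hω <;> simp [hω]

theorem IsRationalOrder.ge_abs (h : IsRationalOrder ge) {f : Ω → ℝ} (hf : ge f 0) :
    ge f |f| := by
  convert h.trans _ _ _ (h.ge_posPart hf)
    (by simpa using h.add_right (h.zero_ge_negPart hf) (fun ω => max (f ω) 0)) using 1
  ext ω
  simp only [Pi.add_apply, Pi.abs_apply]
  rcases le_total (f ω) 0 with hω | hω <;> simp [hω, abs_of_nonneg, abs_of_nonpos]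

/-- The truncated positive part of a strictly positive function is strictly positive. -/
theorem IsRationalOrder.strictGE_posPart_min_one (h : IsRationalOrder ge) {f : Ω → ℝ}
    (hf : StrictGE ge f 0) : StrictGE ge (fun ω => max (min (f ω) 1) 0) 0 :=
  ⟨h.of_pointwise _ _ fun _ => le_max_right _ _, fun h0 =>
    (h.trunc f hf).2 (h.trans _ _ _ h0 (h.of_pointwise _ _ fun _ => le_max_left _ _))⟩

end Order

/-! ### The space of superhedgeable functions and the cone of hedgeable claims -/

section Cone

variable {Ω : Type*} {ge : (Ω → ℝ) → (Ω → ℝ) → Prop} {𝒳 : Set (Ω → ℝ)} {π : 𝒳 → ℝ}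

/-- The superhedgeable functions form a vector space. -/
def superhedgeableSubmodule (hge : IsRationalOrder ge) (h𝒳 : IsAssetSet ge 𝒳) :
    Submodule ℝ (Ω → ℝ) where
  carrier := superhedgeable ge 𝒳
  zero_mem' := ⟨1, one_pos, 1, h𝒳.one_mem, hge.of_pointwise _ _ fun ω => by simp⟩
  add_mem' := by
    rintro g₁ g₂ ⟨c₁, hc₁, X₁, hX₁, h₁⟩ ⟨c₂, hc₂, X₂, hX₂, h₂⟩
    have hc : 0 < c₁ + c₂ := add_pos hc₁ hc₂
    -- Since `𝒳` need not be a cone, the sum of the hedges is rescaled to a convex combination.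
    refine ⟨c₁ + c₂, hc, (c₁ / (c₁ + c₂)) • X₁ + (c₂ / (c₁ + c₂)) • X₂,
      h𝒳.convex hX₁ hX₂ (by positivity) (by positivity) (by field_simp), ?_⟩
    rw [smul_add, smul_smul, smul_smul, mul_div_cancel₀ _ hc.ne', mul_div_cancel₀ _ hc.ne']
    exact hge.trans _ _ _ (hge.add h₁ h₂) (hge.of_pointwise _ _ fun ω => abs_add_le _ _)
  smul_mem' := by
    rintro a g ⟨c, hc, X, hX, h⟩
    refine ⟨(|a| + 1) * c, by positivity, X, hX, ?_⟩
    rw [mul_smul]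
    refine hge.trans _ _ _ (hge.smul h (by positivity)) (hge.of_pointwise _ _ fun ω => ?_)
    simp only [Pi.abs_apply, Pi.smul_apply, smul_eq_mul, abs_mul]
    nlinarith [abs_nonneg (g ω)]

theorem bounded_mem_superhedgeable (hge : IsRationalOrder ge) (h𝒳 : IsAssetSet ge 𝒳)
    {g : Ω → ℝ} {K : ℝ} (hg : ∀ ω, |g ω| ≤ K) : g ∈ superhedgeable ge 𝒳 := by
  refine ⟨max K 1, by positivity, 1, h𝒳.one_mem, hge.of_pointwise _ _ fun ω => ?_⟩
  simpa using Or.inl (hg ω)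

/-- If `X ≥_* a`, then `X + |a| ≥_* 0` is traded and dominates its own absolute value; the constant
is then subtracted. -/
theorem asset_mem_superhedgeable (hge : IsRationalOrder ge) (h𝒳 : IsAssetSet ge 𝒳)
    {X : Ω → ℝ} (hX : X ∈ 𝒳) : X ∈ superhedgeable ge 𝒳 := by
  obtain ⟨a, ha⟩ := h𝒳.limited_loss X hX
  have hX' := h𝒳.add_const_mem X hX |a| (abs_nonneg a)
  have h0 : ge (fun ω => X ω + |a|) 0 :=
    hge.trans _ _ _ (hge.add_right ha fun _ => |a|)
      (hge.of_pointwise _ _ fun ω => by simpa using neg_le_iff_add_nonneg.1 (neg_abs_le a))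
  have h1 : (fun ω => X ω + |a|) ∈ superhedgeable ge 𝒳 :=
    ⟨1, one_pos, _, hX', by simpa using hge.ge_abs h0⟩
  have h2 : (fun _ => |a|) ∈ superhedgeable ge 𝒳 :=
    bounded_mem_superhedgeable hge h𝒳 (K := |a|) fun ω => by simp
  have h3 := (superhedgeableSubmodule hge h𝒳).sub_mem h1 h2
  have h4 : ((fun ω => X ω + |a|) - fun _ => |a|) = X := by
    ext ω
    simp
  rwa [h4] at h3

theorem priceCone_of_ge (hge : IsRationalOrder ge) {f g : Ω → ℝ} (hf : f ∈ priceCone ge 𝒳 π)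
    (h : ge f g) : g ∈ priceCone ge 𝒳 π := by
  obtain ⟨c, hc, X, hX⟩ := hf
  exact ⟨c, hc, X, hge.trans _ _ _ hX h⟩

theorem priceCone_smul (hge : IsRationalOrder ge) {f : Ω → ℝ} (hf : f ∈ priceCone ge 𝒳 π)
    {a : ℝ} (ha : 0 < a) : a • f ∈ priceCone ge 𝒳 π := by
  obtain ⟨c, hc, X, hX⟩ := hf
  refine ⟨a * c, mul_pos ha hc, X, ?_⟩
  convert hge.smul hX ha.le using 1
  ext ω
  simp [mul_assoc]

theorem zero_mem_priceCone (hge : IsRationalOrder ge) (h𝒳 : IsAssetSet ge 𝒳)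
    (hπ : IsPriceFunction ge 𝒳 π) : (0 : Ω → ℝ) ∈ priceCone ge 𝒳 π := by
  refine ⟨1, one_pos, ⟨1, h𝒳.one_mem⟩, hge.of_pointwise _ _ fun ω => ?_⟩
  rw [hπ.normalized _ rfl]
  simp

theorem asset_smul_mem (h𝒳 : IsAssetSet ge 𝒳) {X : Ω → ℝ} (hX : X ∈ 𝒳) {t : ℝ} (h0 : 0 ≤ t)
    (h1 : t ≤ 1) : t • X ∈ 𝒳 := by
  simpa using h𝒳.convex hX h𝒳.zero_mem h0 (sub_nonneg.2 h1) (by ring)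

/-- Both assets are shrunk inside `𝒳` by the weights `cᵢ / (c₁ + c₂)`, so that homogeneity and
subadditivity of `π` apply to their sum, which is a convex combination. -/
theorem priceCone_add (hge : IsRationalOrder ge) (h𝒳 : IsAssetSet ge 𝒳)
    (hπ : IsPriceFunction ge 𝒳 π) {f g : Ω → ℝ} (hf : f ∈ priceCone ge 𝒳 π)
    (hg : g ∈ priceCone ge 𝒳 π) : f + g ∈ priceCone ge 𝒳 π := by
  obtain ⟨c₁, hc₁, ⟨X₁, hX₁⟩, h₁⟩ := hf
  obtain ⟨c₂, hc₂, ⟨X₂, hX₂⟩, h₂⟩ := hg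
  have hc : 0 < c₁ + c₂ := add_pos hc₁ hc₂
  have hY₁ := asset_smul_mem h𝒳 hX₁ (t := c₁ / (c₁ + c₂)) (by positivity)
    (by rw [div_le_one hc]; linarith)
  have hY₂ := asset_smul_mem h𝒳 hX₂ (t := c₂ / (c₁ + c₂)) (by positivity)
    (by rw [div_le_one hc]; linarith)
  have hY : (c₁ / (c₁ + c₂)) • X₁ + (c₂ / (c₁ + c₂)) • X₂ ∈ 𝒳 :=
    h𝒳.convex hX₁ hX₂ (by positivity) (by positivity) (by field_simp)
  have h3 := hπ.subadditive ⟨_, hY₁⟩ ⟨_, hY₂⟩ ⟨_, hY⟩ rfl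
  rw [hπ.pos_homogeneous ⟨X₁, hX₁⟩ ⟨_, hY₁⟩ _ (by positivity) rfl,
    hπ.pos_homogeneous ⟨X₂, hX₂⟩ ⟨_, hY₂⟩ _ (by positivity) rfl] at h3
  refine ⟨c₁ + c₂, hc, ⟨_, hY⟩, hge.trans _ _ _ (hge.of_pointwise _ _ fun ω => ?_)
    (hge.add h₁ h₂)⟩
  have h4 := mul_le_mul_of_nonneg_left h3 hc.le
  have h5 : (c₁ + c₂) * (c₁ / (c₁ + c₂) * π ⟨X₁, hX₁⟩ + c₂ / (c₁ + c₂) * π ⟨X₂, hX₂⟩)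
      = c₁ * π ⟨X₁, hX₁⟩ + c₂ * π ⟨X₂, hX₂⟩ := by field_simp
  have h6 : (c₁ + c₂) * (c₁ / (c₁ + c₂) * X₁ ω + c₂ / (c₁ + c₂) * X₂ ω)
      = c₁ * X₁ ω + c₂ * X₂ ω := by field_simp
  simp only [Pi.add_apply, Pi.smul_apply, smul_eq_mul, mul_sub]
  linarith

/-- Subtract the cost of the superhedge. This makes the separating gauge finite from above. -/
theorem exists_sub_const_mem_priceCone (hge : IsRationalOrder ge) {f : Ω → ℝ}
    (hf : f ∈ superhedgeable ge 𝒳) : ∃ t : ℝ, (f - fun _ => t) ∈ priceCone ge 𝒳 π := by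
  obtain ⟨c, hc, X, hX, h⟩ := hf
  refine ⟨c * π ⟨X, hX⟩, c, hc, ⟨X, hX⟩, ?_⟩
  have h1 := hge.add_right (hge.trans _ _ _ h (hge.of_pointwise _ f fun ω => le_abs_self _))
    (-fun _ => c * π ⟨X, hX⟩)
  convert h1 using 1
  · ext ω
    simp only [Pi.add_apply, Pi.smul_apply, Pi.neg_apply, smul_eq_mul]
    ring
  · rw [sub_eq_add_neg]

theorem mem_uniformClosure_iff {A : Set (Ω → ℝ)} {f : Ω → ℝ} :
    f ∈ uniformClosure A ↔ ∀ ε : ℝ, 0 < ε → ∃ h ∈ A, ∀ ω, |f ω - h ω| ≤ ε := by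
  unfold uniformClosure
  rw [Set.mem_ofPred_eq, mem_closure_iff_nhds_basis
    (UniformFun.hasBasis_nhds_of_basis Ω ℝ _ Metric.uniformity_basis_dist_le)]
  refine forall₂_congr fun ε hε => ⟨?_, ?_⟩
  · rintro ⟨_, ⟨h, hh, rfl⟩, hd⟩
    exact ⟨h, hh, fun ω => hd ω⟩
  · rintro ⟨h, hh, hd⟩
    exact ⟨_, ⟨h, hh, rfl⟩, fun ω => hd ω⟩

end Cone

/-! ### Separation -/

section Separation

variable {Ω : Type*}

/-- Separation of a point from a convex cone that is at positive uniform distance from it. -/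
theorem exists_linearMap_of_sub_const_notMem (L : Submodule ℝ (Ω → ℝ)) (C : Set (Ω → ℝ))
    (hadd : ∀ f ∈ C, ∀ g ∈ C, f + g ∈ C) (hsmul : ∀ f ∈ C, ∀ a : ℝ, 0 < a → a • f ∈ C)
    (hneg : ∀ c : ℝ, c ≤ 0 → (fun _ => c) ∈ C) (hpos : ∀ c : ℝ, 0 < c → (fun _ => c) ∉ C)
    (hone : (fun _ => 1) ∈ L) (hup : ∀ f ∈ L, ∃ t : ℝ, (f - fun _ => t) ∈ C)
    {g : Ω → ℝ} (hg : g ∈ L) {ε : ℝ} (hε : 0 < ε) (hgε : (g - fun _ => ε) ∉ C) :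
    ∃ φ : (Ω → ℝ) →ₗ[ℝ] ℝ, (∀ f ∈ L, f ∈ C → φ f ≤ 0) ∧ φ (fun _ => 1) = 1 ∧ 0 < φ g := by
  let p : (Ω → ℝ) → ℝ := fun f => sInf {t : ℝ | (f - fun _ => t) ∈ C}
  have hbdd : ∀ f ∈ L, BddBelow {t : ℝ | (f - fun _ => t) ∈ C} := by
    -- If `f - t` and `-f - s` are both in `C`, so is the constant `-s - t`, which therefore cannot
    -- be positive.
    intro f hf
    obtain ⟨s, hs⟩ := hup (-f) (L.neg_mem hf)
    refine ⟨-s, fun t ht => ?_⟩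
    by_contra! hlt
    refine hpos (-s - t) (by linarith) ?_
    convert hadd _ ht _ hs using 1
    ext ω
    simp
    ring
  have hle : ∀ f ∈ L, ∀ t : ℝ, (f - fun _ => t) ∈ C → p f ≤ t :=
    fun f hf t ht => csInf_le (hbdd f hf) ht
  have hlt : ∀ f ∈ L, ∀ t : ℝ, p f < t → (f - fun _ => t) ∈ C := by
    intro f hf t ht
    obtain ⟨s, hs, hst⟩ := exists_lt_of_csInf_lt (hup f hf) ht
    convert hadd _ hs _ (hneg (s - t) (by linarith)) using 1
    ext ω
    simp
  have hpadd : ∀ f ∈ L, ∀ f' ∈ L, p (f + f') ≤ p f + p f' := by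
    intro f hf f' hf'
    refine le_of_forall_pos_le_add fun δ hδ => hle _ (L.add_mem hf hf') _ ?_
    convert hadd _ (hlt f hf (p f + δ / 2) (by linarith))
      _ (hlt f' hf' (p f' + δ / 2) (by linarith)) using 1
    ext ω
    simp
    ring
  have hpsmul_le : ∀ a : ℝ, 0 < a → ∀ f ∈ L, p (a • f) ≤ a * p f := by
    intro a ha f hf
    refine le_of_forall_pos_le_add fun δ hδ => hle _ (L.smul_mem a hf) _ ?_
    convert hsmul _ (hlt f hf (p f + δ / a) (by linarith [div_pos hδ ha])) a ha using 1
    ext ω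
    simp
    field_simp
  have hpsmul : ∀ a : ℝ, 0 < a → ∀ f ∈ L, p (a • f) = a * p f := by
    intro a ha f hf
    refine le_antisymm (hpsmul_le a ha f hf) ?_
    have h := hpsmul_le a⁻¹ (inv_pos.2 ha) (a • f) (L.smul_mem a hf)
    rw [smul_smul, inv_mul_cancel₀ ha.ne', one_smul] at h
    rwa [le_inv_mul_iff₀ ha] at h
  have hp0 : p 0 = 0 := by
    have := hpsmul 2 two_pos 0 L.zero_mem
    rw [smul_zero] at this
    linarith
  have hpg : 0 < p g := by
    refine hε.trans_le (not_lt.1 fun h => hgε (hlt g hg ε h))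
  have hg0 : (⟨g, hg⟩ : L) ≠ 0 := by
    intro h
    have h0 : g = 0 := congrArg Subtype.val h
    rw [h0, hp0] at hpg
    exact hpg.false
  obtain ⟨ψ, hψ, hψp⟩ := exists_extension_of_le_sublinear
    (LinearPMap.mkSpanSingleton (K := ℝ) (⟨g, hg⟩ : L) (p g) hg0) (fun x : L => p x)
    (fun c hc x => hpsmul c hc x x.2) (fun x y => hpadd x x.2 y y.2) (by
      rintro ⟨x, hx⟩
      obtain ⟨a, rfl⟩ := Submodule.mem_span_singleton.1 hx
      erw [LinearPMap.mkSpanSingleton'_apply]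
      change a * p g ≤ p (a • g)
      rcases lt_trichotomy a 0 with ha | rfl | ha
      · have h1 := hpsmul (-a) (neg_pos.2 ha) g hg
        have h2 := hpadd (a • g) (L.smul_mem a hg) ((-a) • g) (L.smul_mem _ hg)
        rw [← add_smul, add_neg_cancel, zero_smul, hp0] at h2
        linarith
      · rw [zero_smul, hp0, zero_mul]
      · exact (hpsmul a ha g hg).ge)
  -- The extension beyond `L` is arbitrary; only values on `L` are controlled.
  obtain ⟨φ, hφ⟩ := LinearMap.exists_extend ψ
  have hφψ : ∀ x (hx : x ∈ L), φ x = ψ ⟨x, hx⟩ := fun x hx => LinearMap.congr_fun hφ ⟨x, hx⟩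
  have hφp : ∀ x ∈ L, φ x ≤ p x := fun x hx => (hφψ x hx).trans_le (hψp ⟨x, hx⟩)
  refine ⟨φ, fun f hf hfC => (hφp f hf).trans (hle f hf 0 ?_), le_antisymm ?_ ?_, ?_⟩
  · convert hfC using 1
    ext ω
    simp
  · refine (hφp _ hone).trans (hle _ hone 1 ?_)
    convert hneg 0 le_rfl using 1
    ext ω
    simp
  · have h1 := (hφp _ (L.neg_mem hone)).trans (hle _ (L.neg_mem hone) (-1) (by
      convert hneg 0 le_rfl using 1
      ext ω
      simp))
    rw [map_neg] at h1
    linarith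
  · rw [hφψ g hg]
    have h1 := hψ ⟨⟨g, hg⟩, Submodule.mem_span_singleton_self _⟩
    have h2 := LinearPMap.mkSpanSingleton_apply ℝ ℝ (σ := RingHom.id ℝ) hg0 (p g)
    rw [h2] at h1
    rw [h1]
    exact hpg

end Separation

/-! ### Pricing measures -/

section Pricing

variable {Ω : Type*} {ge : (Ω → ℝ) → (Ω → ℝ) → Prop} {𝒳 : Set (Ω → ℝ)} {π : 𝒳 → ℝ}

/-- A bounded function at positive uniform distance from the cone of hedgeable claims has positive
integral for some pricing measure which respects the order. -/
theorem exists_pricingMeasure (hge : IsRationalOrder ge) (h𝒳 : IsAssetSet ge 𝒳)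
    (hπ : IsPriceFunction ge 𝒳 π) (hconst : ∀ c : ℝ, 0 < c → (fun _ => c) ∉ priceCone ge 𝒳 π)
    {g : Ω → ℝ} (hg0 : ∀ ω, 0 ≤ g ω) (hg1 : ∀ ω, g ω ≤ 1) {ε : ℝ} (hε : 0 < ε)
    (hgε : (g - fun _ => ε) ∉ priceCone ge 𝒳 π) :
    ∃ m ∈ pricingMeasures ge 𝒳 π, (∃ I, 0 < I ∧ HasIntegral m g I) ∧
      ∀ v, ge v 0 → ∀ I, HasIntegral m v I → 0 ≤ I := by
  set L := superhedgeableSubmodule hge h𝒳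
  have hbddL : ∀ u : Ω → ℝ, (∀ ω, 0 ≤ u ω) → (∃ K : ℝ, ∀ ω, u ω ≤ K) → u ∈ L :=
    fun u hu ⟨K, hK⟩ => bounded_mem_superhedgeable hge h𝒳 (K := K) fun ω => by
      rw [abs_of_nonneg (hu ω)]
      exact hK ω
  have hC0 := zero_mem_priceCone hge h𝒳 hπ
  have hgL : g ∈ L := hbddL g hg0 ⟨1, hg1⟩
  have honeL : (fun _ => 1) ∈ L := hbddL _ (fun _ => zero_le_one) ⟨1, fun _ => le_rfl⟩
  obtain ⟨φ, hφC, hone, hφg⟩ := exists_linearMap_of_sub_const_notMem L (priceCone ge 𝒳 π)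
    (fun f hf f' hf' => priceCone_add hge h𝒳 hπ hf hf')
    (fun f hf a ha => priceCone_smul hge hf ha)
    (fun c hc => priceCone_of_ge hge hC0 (hge.of_pointwise _ _ fun _ => hc)) hconst honeL
    (fun f hf => exists_sub_const_mem_priceCone hge hf) hgL hε hgε
  have hφle : ∀ f ∈ L, ge 0 f → φ f ≤ 0 := fun f hf h => hφC f hf (priceCone_of_ge hge hC0 h)
  have hφmono : ∀ f ∈ L, ∀ u ∈ L, (∀ ω, u ω ≤ f ω) → φ u ≤ φ f := by
    intro f hf u hu h
    have h1 := hφle (u - f) (L.sub_mem hu hf)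
      (hge.of_pointwise _ _ fun ω => sub_nonpos.2 (h ω))
    rw [map_sub] at h1
    linarith
  have hpos : ∀ u : Ω → ℝ, (∀ ω, 0 ≤ u ω) → (∃ K : ℝ, ∀ ω, u ω ≤ K) → 0 ≤ φ u := by
    intro u hu hK
    have h1 := hφmono u (hbddL u hu hK) 0 L.zero_mem hu
    rwa [map_zero] at h1
  set m := inducedProb φ hpos hone
  have hint : ∀ f ∈ L, (∀ ω, 0 ≤ f ω) → ∃ I ≤ φ f, HasIntegral m f I := fun f hf hf0 =>
    exists_hasIntegral_inducedProb_le hf0 fun u hu0 huf hK => hφmono f hf u (hbddL u hu0 hK) huf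
  have hposPart : ∀ f ∈ L, (fun ω => max (f ω) 0) ∈ L := by
    rintro f ⟨c, hc, X, hX, h⟩
    refine ⟨c, hc, X, hX, hge.trans _ _ _ h (hge.of_pointwise _ _ fun ω => ?_)⟩
    simp only [Pi.abs_apply]
    rw [abs_of_nonneg (le_max_right _ _)]
    exact max_le (le_abs_self _) (abs_nonneg _)
  have hnegPart : ∀ f ∈ L, (fun ω => max (-f ω) 0) ∈ L := fun f hf =>
    hposPart (-f) (L.neg_mem hf)
  have hdecomp : ∀ f : Ω → ℝ, (fun ω => max (f ω) 0) - (fun ω => max (-f ω) 0) = f := by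
    intro f
    ext ω
    simp
  have hφconst : ∀ c : ℝ, φ (fun _ => c) = c := fun c => by
    have h : (fun _ : Ω => c) = c • fun _ => (1 : ℝ) := by ext; simp
    rw [h, map_smul, hone, smul_eq_mul, mul_one]
  have hconstL : ∀ c : ℝ, (fun _ : Ω => c) ∈ L := fun c =>
    bounded_mem_superhedgeable hge h𝒳 (K := |c|) fun _ => le_rfl
  refine ⟨m, ⟨?_, ?_⟩, ?_, ?_⟩
  · intro f hf
    obtain ⟨I, -, hI⟩ := hint _ (hposPart f hf) fun ω => le_max_right _ _
    obtain ⟨J, -, hJ⟩ := hint _ (hnegPart f hf) fun ω => le_max_right _ _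
    have h := hI.sub hJ
    rw [hdecomp] at h
    exact ⟨_, h⟩
  · rintro ⟨X, hX⟩
    obtain ⟨a, ha⟩ := h𝒳.limited_loss X hX
    have hXL : X ∈ L := asset_mem_superhedgeable hge h𝒳 hX
    have hv := hge.sub_nonneg ha
    set v : Ω → ℝ := X - fun _ => a
    have hvL : v ∈ L := L.sub_mem hXL (hconstL a)
    obtain ⟨I, hIle, hI⟩ := hint _ (hposPart v hvL) fun ω => le_max_right _ _
    obtain ⟨J, -, hJ⟩ := hint _ (hnegPart v hvL) fun ω => le_max_right _ _
    have hJ0 : 0 ≤ J := (hasIntegral_const 0).mono hJ fun ω => le_max_right _ _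
    have h := (hI.sub hJ).add (hasIntegral_const a)
    rw [hdecomp, sub_add_cancel] at h
    rw [h.integral_eq]
    -- `φ` is non-positive on the negative part of `v`, so `∫ v ≤ ∫ v⁺ ≤ φ v⁺ ≤ φ v`.
    have h1 := hφle _ (hnegPart v hvL) (hge.zero_ge_negPart hv)
    have h2 : φ v = φ (fun ω => max (v ω) 0) - φ (fun ω => max (-v ω) 0) := by
      rw [← map_sub, hdecomp]
    have h3 : φ v = φ X - a := by rw [map_sub, hφconst]
    have h4 := hφC (X - fun _ => π ⟨X, hX⟩) (L.sub_mem hXL (hconstL _))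
      ⟨1, one_pos, ⟨X, hX⟩, hge.of_pointwise _ _ fun ω => by simp⟩
    rw [map_sub, hφconst] at h4
    linarith
  · obtain ⟨I, -, hI⟩ := hint g hgL hg0
    -- The upper bound applied to `1 - g` supplies the lower bound `φ g ≤ ∫ g`.
    obtain ⟨J, hJle, hJ⟩ := hint ((fun _ => 1) - g) (L.sub_mem honeL hgL) fun ω =>
      sub_nonneg.2 (hg1 ω)
    refine ⟨I, ?_, hI⟩
    have h := hI.add hJ
    rw [add_sub_cancel] at h
    have h1 := h.unique (hasIntegral_const 1)
    rw [map_sub, hone] at hJle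
    linarith
  · intro v hv I hI
    -- The indicator of `{v < -δ}` is at most `δ⁻¹` times the negative part of `v`, which `0`
    -- dominates for `≥_*`.
    refine hI.nonneg_of_null fun δ hδ => le_antisymm ?_ (m.nonneg _)
    refine hφle _ (hbddL _ (fun ω => Set.indicator_nonneg (fun _ _ => zero_le_one) ω)
      ⟨1, fun ω => Set.indicator_le_self' (fun _ _ => zero_le_one) ω⟩) ?_
    have h1 := hge.smul (hge.zero_ge_negPart hv) (inv_nonneg.2 hδ.le)
    rw [smul_zero] at h1
    refine hge.trans _ _ _ h1 (hge.of_pointwise _ _ fun ω => ?_)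
    simp only [Pi.smul_apply, smul_eq_mul]
    by_cases hω : ω ∈ {ω | v ω < -δ}
    · rw [Set.indicator_of_mem hω, le_inv_mul_iff₀ hδ, mul_one]
      have h2 : v ω < -δ := hω
      exact le_max_of_le_left (by linarith)
    · rw [Set.indicator_of_notMem hω]
      exact mul_nonneg (inv_nonneg.2 hδ.le) (le_max_right _ _)

theorem uniformClosure_subset_L1Closure (hge : IsRationalOrder ge) (h𝒳 : IsAssetSet ge 𝒳)
    {m : FinAddProb Ω} (hm : m ∈ pricingMeasures ge 𝒳 π) (A : Set (Ω → ℝ)) :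
    uniformClosure A ⊆ L1Closure m A := by
  intro f hf ε hε
  obtain ⟨h, hh, hd⟩ := mem_uniformClosure_iff.1 hf (ε / 2) (half_pos hε)
  have hL : f - h ∈ L1 m := hm.1 (bounded_mem_superhedgeable hge h𝒳 hd)
  refine ⟨h, hh, hL, ?_⟩
  have := (hasIntegral_integral (abs_mem_L1 hL)).mono (hasIntegral_const (ε / 2)) hd
  linarith

end Pricing

end FinAddMarket

theorem mainTheorem8 {Ω : Type*} [Nonempty Ω]
    (ge : (Ω → ℝ) → (Ω → ℝ) → Prop) (hge : FinAddMarket.IsRationalOrder ge)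
    (𝒳 : Set (Ω → ℝ)) (h𝒳 : FinAddMarket.IsAssetSet ge 𝒳)
    (π : 𝒳 → ℝ) (hπ : FinAddMarket.IsPriceFunction ge 𝒳 π) :
    FinAddMarket.uniformClosure (FinAddMarket.priceCone ge 𝒳 π) ∩
        {f : Ω → ℝ | FinAddMarket.StrictGE ge f 0} = ∅ ↔
      (⋂ m ∈ FinAddMarket.pricingMeasures ge 𝒳 π,
          FinAddMarket.L1Closure m (FinAddMarket.priceCone ge 𝒳 π)) ∩
        {f : Ω → ℝ | FinAddMarket.StrictGE ge f 0} = ∅ := by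
  open FinAddMarket in
  constructor
  · intro hempty
    refine Set.eq_empty_of_forall_notMem ?_
    rintro f ⟨hf, hfpos⟩
    have hnot : ∀ u, StrictGE ge u 0 → u ∉ uniformClosure (priceCone ge 𝒳 π) :=
      fun u hu hmem => (Set.ext_iff.1 hempty u).1 ⟨hmem, hu⟩
    have hconst : ∀ c : ℝ, 0 < c → (fun _ => c) ∉ priceCone ge 𝒳 π := by
      intro c hc hmem
      have h1 : (1 : Ω → ℝ) ∈ priceCone ge 𝒳 π := by
        convert priceCone_smul hge hmem (inv_pos.2 hc) using 1
        ext ω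
        simp [hc.ne']
      exact hnot 1 hge.one_gt_zero
        (mem_uniformClosure_iff.2 fun ε hε => ⟨1, h1, fun ω => by simp [hε.le]⟩)
    have hgpos := hge.strictGE_posPart_min_one hfpos
    set g : Ω → ℝ := fun ω => max (min (f ω) 1) 0
    obtain ⟨ε, hε, hgε⟩ : ∃ ε : ℝ, 0 < ε ∧ (g - fun _ => ε) ∉ priceCone ge 𝒳 π := by
      by_contra! hcon
      refine hnot g hgpos (mem_uniformClosure_iff.2 fun ε hε => ⟨_, hcon ε hε, fun ω => ?_⟩)
      simp [abs_of_pos hε]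
    obtain ⟨m, hm, ⟨I, hI0, hI⟩, hnn⟩ := exists_pricingMeasure hge h𝒳 hπ hconst
      (fun ω => le_max_right _ _) (fun ω => max_le (min_le_right _ _) zero_le_one) hε hgε
    -- The tolerance is `∫ g dm` itself. Neither `f` nor `h` need be integrable, only `f - h`.
    obtain ⟨h, ⟨c, hc, ⟨X, hX⟩, hXh⟩, hL, hlt⟩ := Set.mem_iInter₂.1 hf m hm I hI0
    have hX1 := hasIntegral_integral (hm.1 (asset_mem_superhedgeable hge h𝒳 hX))
    have hXle := hm.2 ⟨X, hX⟩
    have hw := hasIntegral_integral hL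
    have hwle := hw.mono (hasIntegral_integral (abs_mem_L1 hL)) fun ω => le_abs_self _
    have hu := (hX1.sub (hasIntegral_const (π ⟨X, hX⟩))).const_smul c
    have hfg : ge f g := hge.trans _ _ _ (hge.ge_posPart hfpos.1)
      (hge.of_pointwise _ _ fun ω => max_le_max (min_le_left _ _) le_rfl)
    have hsum : ge (c • (X - fun _ => π ⟨X, hX⟩) + (f - h)) f := by
      have h1 := hge.add_right hXh (f - h)
      rwa [add_sub_cancel] at h1
    have h2 := hnn _ (hge.sub_nonneg (hge.trans _ _ _ hsum hfg)) _ ((hu.add hw).sub hI)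
    have h3 := mul_nonpos_of_nonneg_of_nonpos hc.le (sub_nonpos.2 hXle)
    linarith
  · intro hempty
    refine Set.eq_empty_of_forall_notMem ?_
    rintro f ⟨hf, hfpos⟩
    exact (Set.ext_iff.1 hempty f).1
      ⟨Set.mem_iInter₂.2 fun m hm => uniformClosure_subset_L1Closure hge h𝒳 hm _ hf, hfpos⟩
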